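/- Let $G=(V,E)$ be a fixed finite simple graph (the base graph) with $n$ vertices. An unknown set $S\subseteq V$ is accessed through queries "is $i\in S$?" with $i\in V$. For a graph property $\mathcal P$, let $cost(\mathcal P,G)$ be the deterministic query complexity of deciding whether the induced subgraph $G[S]$ satisfies $\mathcal P$, that is, the least worst-case number of queries of a deterministic decision tree for this problem; let $cost_R(\mathcal P,G)$ be the randomized one, that is, the least depth of a probability distribution on decision trees that answers correctly with probability at least $2/3$ on every $S$. The graph $G$ is relevant for $\mathcal P$ if for every vertex $i$ there is a set $S\ni i$ such that exactly one of $G[S]$ and $G[S\setminus\{i\}]$ satisfies $\mathcal P$. A graph is planar if it can be embedded in the plane, with vertices as distinct points and edges as simple arcs between their end vertices that meet only in common end vertices and contain no other vertices. Theorem. Let $\mathcal P$ be planarity. There is an absolute constant $c>0$ such that for every finite vertex-transitive graph $G$ of degree at least $7$ that is relevant for planarity, $$c\,n\le cost(\mathcal P,G)\le n\qquad\text{and}\qquad c\,n\le cost_R(\mathcal P,G)\le n,\qquad n=|V(G)|.$$ Consequently, if $\mathcal G$ is the class of vertex-transitive graphs of degree at least $7$, then $$\mathcal G\text{-}min\text{-}cost_n(\mathcal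 P)=\min\{cost(\mathcal P,G) : G\in\mathcal G,\ G\text{ is relevant for }\mathcal P,\ |V(G)|=n\}=\Theta(n)\qquad(n\to\infty).$$ -/

import Mathlib

open Filter Asymptotics

universe u

namespace NodeQuery

/-! ### Decision trees -/

/-- A deterministic decision tree over Boolean variables indexed by `V`: a leaf gives an answer,
an inner node asks "is `x i = 1`?" and continues in `no` or in `yes`. -/
inductive DecisionTree (V : Type u) : Type u
  | leaf (answer : Bool) : DecisionTree V
  | query (i : V) (no yes : DecisionTree V) : DecisionTree V

namespace DecisionTree

variable {V : Type u}

/-- The answer of the tree on the input `x`. -/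
def eval : DecisionTree V → (V → Bool) → Bool
  | leaf b, _ => b
  | query i no yes, x => if x i then yes.eval x else no.eval x

/-- The number of queries that the tree makes on the input `x`. -/
def cost : DecisionTree V → (V → Bool) → ℕ
  | leaf _, _ => 0
  | query i no yes, x => 1 + if x i then yes.cost x else no.cost x

/-- The depth of the tree: the maximal number of queries on a branch. -/
def depth : DecisionTree V → ℕ
  | leaf _ => 0
  | query _ no yes => 1 + max no.depth yes.depth

end DecisionTree

/-- The deterministic query complexity `D(f)`: the least worst-case number of queries of
a decision tree that computes `f`. -/
noncomputable def detComplexity {V : Type u} (f : (V → Bool) → Bool) : ℕ :=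
  sInf {k | ∃ T : DecisionTree V, (∀ x, T.eval x = f x) ∧ ∀ x, T.cost x ≤ k}

/-- The bounded-error randomized query complexity `R(f)`: the least depth of a probability
distribution on decision trees that, on every input, gives the right answer with
probability at least `2/3`. -/
noncomputable def randComplexity {V : Type u} (f : (V → Bool) → Bool) : ℕ :=
  sInf {k | ∃ μ : PMF (DecisionTree V),
    (∀ x, (2 / 3 : ENNReal) ≤ μ.toOuterMeasure {T | T.eval x = f x}) ∧
      ∀ T ∈ μ.support, T.depth ≤ k}

/-! ### Graph properties in the node-query model -/

/-- A graph property (or a class of graphs) is a collection of graphs. -/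
abbrev GraphProperty : Type (u + 1) := (V : Type u) → SimpleGraph V → Prop

/-- `G[S]` satisfies `P`, where `G[S]` is the subgraph of `G` induced on `S`. -/
def InducedSatisfies (P : GraphProperty.{u}) {V : Type u} (G : SimpleGraph V) (S : Set V) : Prop :=
  P S (G.induce S)

open Classical in
/-- The Boolean function of the node-query problem: the input is the indicator function of the
unknown vertex set `S`, and the value says whether `G[S]` satisfies `P`. -/
noncomputable def nodeFunction (P : GraphProperty.{u}) {V : Type u} (G : SimpleGraph V)
    (x : V → Bool) : Bool :=
  decide (InducedSatisfies P G {v | x v = true})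

/-- `cost(P, G)`: the number of node queries needed in the worst case to decide whether
`G[S]` satisfies `P`. -/
noncomputable def graphCost (P : GraphProperty.{u}) {V : Type u} (G : SimpleGraph V) : ℕ :=
  detComplexity (nodeFunction P G)

/-- The randomized (bounded-error) version of `cost(P, G)`. -/
noncomputable def randGraphCost (P : GraphProperty.{u}) {V : Type u} (G : SimpleGraph V) : ℕ :=
  randComplexity (nodeFunction P G)

/-- The vertex `i` of `G` is relevant for `P`: for some `S` containing `i`, exactly one of `G[S]`
and `G[S - {i}]` satisfies `P`. -/
def IsRelevantVertex (P : GraphProperty.{u}) {V : Type u} (G : SimpleGraph V) (i : V) : Prop :=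
  ∃ S : Set V, i ∈ S ∧ Xor (InducedSatisfies P G S) (InducedSatisfies P G (S \ {i}))

/-- `G` is relevant for `P`: all its vertices are. -/
def IsRelevant (P : GraphProperty.{u}) {V : Type u} (G : SimpleGraph V) : Prop :=
  ∀ i : V, IsRelevantVertex P G i

/-- `𝒢-min-cost_n(P)`: the least `cost(P, G)` over the graphs `G` in `𝒢` with `n` vertices
that are relevant for `P`. -/
noncomputable def minCost (𝒢 P : GraphProperty.{u}) (n : ℕ) : ℕ :=
  sInf {k | ∃ (V : Type u) (G : SimpleGraph V), Finite V ∧ Nat.card V = n ∧ 𝒢 V G ∧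
    IsRelevant P G ∧ graphCost P G = k}

/-! ### Planarity and vertex-transitivity -/

/-- An embedding of `G` in the Euclidean plane: vertices are distinct points, every edge is a simple
arc joining its two end vertices, no arc has a vertex in its interior, and an
interior point of one arc lies on no other arc. -/
structure PlaneEmbedding {V : Type u} (G : SimpleGraph V) where
  /-- The point that represents a vertex. -/
  point : V → EuclideanSpace ℝ (Fin 2)
  point_injective : Function.Injective point
  /-- The arc that represents an edge. -/
  arc : G.edgeSet → C(unitInterval, EuclideanSpace ℝ (Fin 2))
  arc_injective : ∀ e, Function.Injective (arc e)
  arc_ends : ∀ e : G.edgeSet, ∃ v w : V, (e : Sym2 V) = s(v, w) ∧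
    arc e 0 = point v ∧ arc e 1 = point w
  arc_avoids_points : ∀ (e : G.edgeSet) (t : unitInterval) (v : V),
    arc e t = point v → t = 0 ∨ t = 1
  arcs_disjoint : ∀ e f : G.edgeSet, e ≠ f → ∀ s t : unitInterval,
    arc e s = arc f t → s = 0 ∨ s = 1

/-- Planarity: being embeddable in the plane. -/
def planarity : GraphProperty.{u} := fun _ G => Nonempty (PlaneEmbedding G)

/-- Vertex-transitivity: every vertex is mapped to every other one by an automorphism. -/
def IsVertexTransitive {V : Type u} (G : SimpleGraph V) : Prop :=
  ∀ v w : V, ∃ φ : G ≃g G, φ v = w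

/-- The class of vertex-transitive graphs in which all degrees are at least `d`. -/
def transitiveOfDegreeAtLeast (d : ℕ) : GraphProperty.{u} := fun _ G =>
  IsVertexTransitive G ∧ ∀ v, d ≤ (G.neighborSet v).ncard

end NodeQuery

/-!
The lower bounds rest on sensitivity. Let `S` be a maximal vertex set such that `G[S]` is planar.
Adding any vertex outside `S` destroys planarity, so the input `S` has `k = n - |S|` sensitive
variables. A decision tree queries all of them on `S`, and a random tree queries each of them with
probability at least `1 / 3`; hence the costs are at least `k` and `k / 3`. Vertex-transitivity
makes `G` regular, of degree `d ≥ 7`, so the degrees in `G[S]` sum to at least `d (n - k) - d k`.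
A planar graph on `n - k` vertices has at most `3 (n - k)` edges, and `n ≤ 8 k` follows
(`card_le_eight_mul_ncard_compl`).

The bound on the number of edges is proved without faces and without the Jordan curve theorem.
Call a graph weakly drawable (`WeaklyDrawable`) if its vertices and edges can be mapped to points
and paths in the plane such that edges without a common end do not meet. A plane embedding is such
a drawing, and weak drawability, unlike an embedding by arcs, is trivially preserved when an edge
is contracted. As in Mader's theorem on complete minors, a smallest weakly drawable graph with
`3 n - 1` edges has every edge in three triangles and a vertex of degree at most five, whose
neighbourhood yields a complete graph on five vertices (`WeaklyDrawable.card_edgeFinset_lt`).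

That the complete graph on five vertices is not weakly drawable (`not_joinedIn_fin_five`) is the
case of graphs in the plane of the van Kampen-Flores theorem. The proof counts, modulo 2, the full
turns of the directions between points of disjoint edges, by means of continuous logarithms on
squares.

The same counting shows that a vertex-transitive graph of degree at least seven is nonplanar, and
an automorphism can move a maximal planar set away from any vertex, so such a graph is always
relevant. In particular complete graphs are, which makes the minimum one over a nonempty set for
all `n > 7`.
-/

namespace NodeQuery

/-! ### Five points in the plane -/

/-- A nonvanishing continuous function on a simply connected space has a continuous logarithm. -/
lemma exists_continuous_log {A : Type*} [TopologicalSpace A] [SimplyConnectedSpace A]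
    [LocallyPathConnectedSpace A] (a : A) {f : A → ℂ} (hf : Continuous f) (h0 : ∀ x, f x ≠ 0) :
    ∃ g : A → ℂ, Continuous g ∧ ∀ x, Complex.exp (g x) = f x := by
  obtain ⟨g, ⟨-, hg⟩, -⟩ := Complex.isCoveringMapOn_exp.existsUnique_continuousMap_lifts
    ⟨f, hf⟩ (a₀ := a) (e₀ := Complex.log (f a)) (Complex.exp_log (h0 a)) h0
  exact ⟨g, g.continuous, fun x => congrFun hg x⟩

/-- `z` is the total change along `[0, 1]` of a continuous logarithm of `f`. -/
def IsLogChange (f : ℝ → ℂ) (z : ℂ) : Prop :=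
  ∃ g : ℝ → ℂ, Continuous g ∧ (∀ s, Complex.exp (g s) = f s) ∧ z = g 1 - g 0

lemma IsLogChange.unique {f : ℝ → ℂ} {z w : ℂ} (hz : IsLogChange f z) (hw : IsLogChange f w) :
    z = w := by
  obtain ⟨g, hgc, hg, rfl⟩ := hz
  obtain ⟨h, hhc, hh, rfl⟩ := hw
  have hfc : Continuous f := by
    have : f = fun s => Complex.exp (g s) := funext fun s => (hg s).symm
    rw [this]; fun_prop
  have e0 : Complex.exp (g 0) = Complex.exp (h 0) := by rw [hg, hh]
  obtain ⟨F, -, hF⟩ := Complex.isCoveringMapOn_exp.existsUnique_continuousMap_lifts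
    ⟨f, hfc⟩ (a₀ := 0) (e₀ := g 0) (hg 0) (fun s => by
      change f s ≠ 0
      rw [← hg s]; exact Complex.exp_ne_zero _)
  have h1 := hF ⟨g, hgc⟩ ⟨rfl, funext hg⟩
  have h2 := hF ⟨fun s => h s + (g 0 - h 0), by fun_prop⟩ ⟨by simp, funext fun s => by
    have h0 : f 0 ≠ 0 := hh 0 ▸ Complex.exp_ne_zero _
    simp [Complex.exp_add, Complex.exp_sub, e0, hh, h0]⟩
  have h3 := DFunLike.congr_fun (h1.trans h2.symm) 1
  simp only [ContinuousMap.coe_mk] at h3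
  rw [h3]; ring

/-- If the paths `γ` and `δ` never meet, then the changes of the logarithm of `γ s - δ t` along the
four sides of the unit square, taken with the orientation of the boundary, add up to zero. On each
side the difference is written with the moving point first: the sign does not affect the change. -/
lemma exists_isLogChange_square {γ δ : ℝ → ℂ} (hγ : Continuous γ) (hδ : Continuous δ)
    (h : ∀ s t, γ s ≠ δ t) :
    ∃ a b c d : ℂ, IsLogChange (fun s => γ s - δ 1) a ∧ IsLogChange (fun s => γ s - δ 0) b ∧
      IsLogChange (fun t => δ t - γ 1) c ∧ IsLogChange (fun t => δ t - γ 0) d ∧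
      a - b = c - d := by
  obtain ⟨g, hgc, hg⟩ := exists_continuous_log (A := ℝ × ℝ) (0, 0)
    (f := fun x => γ x.1 - δ x.2) (by fun_prop) (fun x => sub_ne_zero.2 (h _ _))
  refine ⟨g (1, 1) - g (0, 1), g (1, 0) - g (0, 0), g (1, 1) - g (1, 0), g (0, 1) - g (0, 0),
    ⟨fun s => g (s, 1), by fun_prop, fun s => hg _, rfl⟩,
    ⟨fun s => g (s, 0), by fun_prop, fun s => hg _, rfl⟩,
    ⟨fun t => g (1, t) + Real.pi * Complex.I, by fun_prop, fun t => ?_, by ring⟩,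
    ⟨fun t => g (0, t) + Real.pi * Complex.I, by fun_prop, fun t => ?_, by ring⟩, by ring⟩ <;>
  simp [Complex.exp_add, hg]

/-- A logarithm of `p y - p x`, normalised so that reversing the direction changes it by `π i`
in a way that depends only on the order of `x` and `y`. -/
noncomputable def directionLog (p : Fin 5 → ℂ) (x y : Fin 5) : ℂ :=
  if x < y then Complex.log (p y - p x) else Complex.log (p x - p y) + Real.pi * Complex.I

lemma exp_directionLog {p : Fin 5 → ℂ} {x y : Fin 5} (h : p x ≠ p y) :
    Complex.exp (directionLog p x y) = p y - p x := by
  unfold directionLog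
  split_ifs
  · exact Complex.exp_log (sub_ne_zero.2 h.symm)
  · rw [Complex.exp_add, Complex.exp_log (sub_ne_zero.2 h), Complex.exp_pi_mul_I]; ring

lemma directionLog_swap (p : Fin 5 → ℂ) {x y : Fin 5} (h : x ≠ y) :
    directionLog p x y = directionLog p y x - Real.pi * Complex.I +
      2 * Real.pi * Complex.I * ((if y < x then 1 else 0 : ℤ) : ℂ) := by
  unfold directionLog
  rcases lt_or_gt_of_ne h with h' | h'
  · simp [h', h'.not_gt]
  · simp [h', h'.not_gt]; ring

/-- A strong form of the nonplanarity of the complete graph on five vertices: of ten paths that join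
five points of the plane pairwise, two paths without a common end always meet. Paths with a common
end may intersect in any way, and a path may intersect itself.

Along the path `ij` the direction as seen from a third point `l` turns by an integer `n i j l` of
full turns more than prescribed by `directionLog`. For disjoint pairs `ij` and `kl` the boundary
relation of the square relates `n i j l`, `n i j k`, `n k l j` and `n k l i`, up to a sign term
that is odd exactly when the two pairs interleave. In the sum over all fifteen disjoint pairs, each
`n i j l` occurs twice, whereas five pairs interleave. -/
theorem not_joinedIn_fin_five (p : Fin 5 → ℂ) (C : Fin 5 → Fin 5 → Set ℂ)
    (hJ : ∀ i j, i < j → JoinedIn (C i j) (p i) (p j))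
    (hD : ∀ i j k l, i < j → k < l → i ≠ k → i ≠ l → j ≠ k → j ≠ l →
      Disjoint (C i j) (C k l)) : False := by
  have hγ : ∀ i j, ∃ γ : ℝ → ℂ, i < j →
      Continuous γ ∧ γ 0 = p i ∧ γ 1 = p j ∧ ∀ s, γ s ∈ C i j := by
    intro i j
    by_cases h : i < j
    · obtain ⟨γ, hγ⟩ := hJ i j h
      refine ⟨γ.extend, fun _ => ⟨γ.continuous_extend, by simp, by simp, fun s => ?_⟩⟩
      have : γ.extend s ∈ Set.range γ.extend := ⟨s, rfl⟩
      rw [γ.extend_range] at this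
      obtain ⟨t, ht⟩ := this
      exact ht ▸ hγ t
    · exact ⟨0, fun h' => absurd h' h⟩
  choose γ hγ using hγ
  have hsq : ∀ i j k l, i < j → k < l → i ≠ k → i ≠ l → j ≠ k → j ≠ l → ∃ a b c d : ℂ,
      IsLogChange (fun s => γ i j s - p l) a ∧ IsLogChange (fun s => γ i j s - p k) b ∧
      IsLogChange (fun t => γ k l t - p j) c ∧ IsLogChange (fun t => γ k l t - p i) d ∧
      a - b = c - d := by
    intro i j k l hij hkl h1 h2 h3 h4
    obtain ⟨c1, e1, e2, m1⟩ := hγ i j hij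
    obtain ⟨c2, e3, e4, m2⟩ := hγ k l hkl
    have := exists_isLogChange_square c1 c2 fun s t hst =>
      Set.disjoint_left.1 (hD i j k l hij hkl h1 h2 h3 h4) (m1 s) (hst ▸ m2 t)
    rwa [e1, e2, e3, e4] at this
  have hchange : ∀ i j l, i < j → l ≠ i → l ≠ j →
      ∃ z, IsLogChange (fun s => γ i j s - p l) z := by
    intro i j l hij hi hj
    -- Any fourth point `k` makes `l` an end of a path without a common end with `ij`.
    obtain ⟨k, hki, hkj, hkl⟩ : ∃ k : Fin 5, k ≠ i ∧ k ≠ j ∧ k ≠ l := by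
      revert i j l; decide
    rcases lt_or_gt_of_ne hkl with h | h
    · obtain ⟨a, b, c, d, ha, -⟩ := hsq i j k l hij h hki.symm hi.symm hkj.symm hj.symm
      exact ⟨a, ha⟩
    · obtain ⟨a, b, c, d, -, hb, -⟩ := hsq i j l k hij h hi.symm hki.symm hj.symm hkj.symm
      exact ⟨b, hb⟩
  have hturn : ∀ i j l, ∃ n : ℤ, i < j → l ≠ i → l ≠ j →
      IsLogChange (fun s => γ i j s - p l)
        (directionLog p l j - directionLog p l i + n * (2 * Real.pi * Complex.I)) := by
    intro i j l
    by_cases h : i < j ∧ l ≠ i ∧ l ≠ j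
    · obtain ⟨hij, hi, hj⟩ := h
      obtain ⟨z, hz⟩ := hchange i j l hij hi hj
      obtain ⟨g, hgc, hg, hzg⟩ := id hz
      obtain ⟨-, e1, e2, -⟩ := hγ i j hij
      have h0 := hg 0
      have h1 := hg 1
      simp only [e1, e2] at h0 h1
      have n0 : p l ≠ p i := (sub_ne_zero.1 (h0 ▸ Complex.exp_ne_zero _)).symm
      have n1 : p l ≠ p j := (sub_ne_zero.1 (h1 ▸ Complex.exp_ne_zero _)).symm
      have : Complex.exp z = Complex.exp (directionLog p l j - directionLog p l i) := by
        rw [hzg, Complex.exp_sub, Complex.exp_sub, h0, h1, exp_directionLog n0,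
          exp_directionLog n1]
      obtain ⟨n, hn⟩ := Complex.exp_eq_exp_iff_exists_int.1 this
      exact ⟨n, fun _ _ _ => hn ▸ hz⟩
    · exact ⟨0, fun a b c => absurd ⟨a, b, c⟩ h⟩
  choose n hn using hturn
  have key : ∀ i j k l, i < j → k < l → i ≠ k → i ≠ l → j ≠ k → j ≠ l →
      n i j l - n i j k - n k l j + n k l i + ((if j < l then 1 else 0) - (if i < l then 1 else 0)
        - (if j < k then 1 else 0) + (if i < k then 1 else 0)) = (0 : ℤ) := by
    intro i j k l hij hkl h1 h2 h3 h4
    obtain ⟨a, b, c, d, ha, hb, hc, hd, habcd⟩ := hsq i j k l hij hkl h1 h2 h3 h4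
    rw [ha.unique (hn i j l hij h2.symm h4.symm), hb.unique (hn i j k hij h1.symm h3.symm),
      hc.unique (hn k l j hkl h3 h4), hd.unique (hn k l i hkl h1 h2),
      directionLog_swap p h4.symm, directionLog_swap p h2.symm, directionLog_swap p h3.symm,
      directionLog_swap p h1.symm] at habcd
    have hpi : (2 * Real.pi * Complex.I : ℂ) ≠ 0 := Complex.two_pi_I_ne_zero
    rw [← Int.cast_inj (α := ℂ)]
    refine mul_left_cancel₀ hpi ?_
    push_cast
    push_cast at habcd
    linear_combination habcd
  have k1 := key 0 1 2 3 (by decide) (by decide) (by decide) (by decide) (by decide) (by decide)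
  have k2 := key 0 1 2 4 (by decide) (by decide) (by decide) (by decide) (by decide) (by decide)
  have k3 := key 0 1 3 4 (by decide) (by decide) (by decide) (by decide) (by decide) (by decide)
  have k4 := key 0 2 1 3 (by decide) (by decide) (by decide) (by decide) (by decide) (by decide)
  have k5 := key 0 2 1 4 (by decide) (by decide) (by decide) (by decide) (by decide) (by decide)
  have k6 := key 0 2 3 4 (by decide) (by decide) (by decide) (by decide) (by decide) (by decide)
  have k7 := key 0 3 1 2 (by decide) (by decide) (by decide) (by decide) (by decide) (by decide)
  have k8 := key 0 3 1 4 (by decide) (by decide) (by decide) (by decide) (by decide) (by decide)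
  have k9 := key 0 3 2 4 (by decide) (by decide) (by decide) (by decide) (by decide) (by decide)
  have k10 := key 0 4 1 2 (by decide) (by decide) (by decide) (by decide) (by decide) (by decide)
  have k11 := key 0 4 1 3 (by decide) (by decide) (by decide) (by decide) (by decide) (by decide)
  have k12 := key 0 4 2 3 (by decide) (by decide) (by decide) (by decide) (by decide) (by decide)
  have k13 := key 1 2 3 4 (by decide) (by decide) (by decide) (by decide) (by decide) (by decide)
  have k14 := key 1 3 2 4 (by decide) (by decide) (by decide) (by decide) (by decide) (by decide)
  have k15 := key 1 4 2 3 (by decide) (by decide) (by decide) (by decide) (by decide) (by decide)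
  simp at k1 k2 k3 k4 k5 k6 k7 k8 k9 k10 k11 k12 k13 k14 k15
  omega

/-! ### Drawings in which disjoint edges do not meet -/

/-- `G` has a drawing in the complex plane in which edges without a common end do not meet.
The edge `xy` is drawn as some path from `p x` to `p y` inside a set `C x y`; nothing is required
of the points `p x` or of edges that share an end. -/
def WeaklyDrawable {V : Type*} (G : SimpleGraph V) : Prop :=
  ∃ (p : V → ℂ) (C : V → V → Set ℂ), (∀ x y, G.Adj x y → JoinedIn (C x y) (p x) (p y)) ∧
    ∀ x y z w, G.Adj x y → G.Adj z w → x ≠ z → x ≠ w → y ≠ z → y ≠ w →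
      Disjoint (C x y) (C z w)

/-- The graph obtained from `G` by identifying `v` with `u`. The vertex `v` stays in the type
as an isolated vertex. -/
def contract {V : Type*} (G : SimpleGraph V) (u v : V) : SimpleGraph V where
  Adj x y := x ≠ y ∧ x ≠ v ∧ y ≠ v ∧
    (G.Adj x y ∨ (x = u ∧ G.Adj v y) ∨ (y = u ∧ G.Adj v x))
  symm := ⟨fun x y h => by
    obtain ⟨h1, h2, h3, h4⟩ := h
    refine ⟨h1.symm, h3, h2, ?_⟩
    rw [G.adj_comm y x]
    tauto⟩
  loopless := ⟨fun x h => h.1 rfl⟩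

section

variable {V : Type*} {G H : SimpleGraph V}

lemma WeaklyDrawable.mono (hG : WeaklyDrawable G) (h : H ≤ G) : WeaklyDrawable H := by
  obtain ⟨p, C, hJ, hD⟩ := hG
  exact ⟨p, C, fun x y hxy => hJ x y (h hxy),
    fun x y z w hxy hzw => hD x y z w (h hxy) (h hzw)⟩

/-- Contracting an edge `uv` keeps the drawing: an edge `vy` is redrawn from `u` through `v`. -/
lemma WeaklyDrawable.contract (hG : WeaklyDrawable G) {u v : V} (huv : G.Adj u v) :
    WeaklyDrawable (contract G u v) := by
  classical
  obtain ⟨p, C, hJ, hD⟩ := hG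
  -- `K y` carries the new edge between `u` and `y`.
  let K : V → Set ℂ := fun y => if G.Adj u y then C u y else C u v ∪ C v y
  have hK : ∀ y, y ≠ v → (G.Adj u y ∨ G.Adj v y) → JoinedIn (K y) (p u) (p y) := by
    intro y hy h
    by_cases huy : G.Adj u y
    · simpa [K, huy] using hJ u y huy
    · have hvy := h.resolve_left huy
      simp only [K, huy, if_false]
      exact ((hJ u v huv).mono Set.subset_union_left).trans
        ((hJ v y hvy).mono Set.subset_union_right)
  have hKD : ∀ y z w, (G.Adj u y ∨ G.Adj v y) → G.Adj z w → u ≠ z → u ≠ w → v ≠ z → v ≠ w →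
      y ≠ z → y ≠ w → Disjoint (K y) (C z w) := by
    intro y z w h hzw h1 h2 h3 h4 h5 h6
    by_cases huy : G.Adj u y
    · simpa [K, huy] using hD u y z w huy hzw h1 h2 h5 h6
    · have hvy := h.resolve_left huy
      simp only [K, huy, if_false, Set.disjoint_union_left]
      exact ⟨hD u v z w huv hzw h1 h2 h3 h4, hD v y z w hvy hzw h3 h4 h5 h6⟩
  let C' : V → V → Set ℂ := fun x y => if x = u then K y else if y = u then K x else C x y
  refine ⟨p, C', ?_, ?_⟩
  · rintro x y ⟨hxy, hxv, hyv, h⟩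
    by_cases hx : x = u
    · subst hx
      simp only [C', if_true]
      refine hK y hyv ?_
      rcases h with h | h | h
      · exact Or.inl h
      · exact Or.inr h.2
      · exact absurd h.1.symm hxy
    · by_cases hy : y = u
      · subst hy
        simp only [C', hx, if_true, if_false]
        refine (hK x hxv ?_).symm
        rcases h with h | h | h
        · exact Or.inl h.symm
        · exact absurd h.1 hx
        · exact Or.inr h.2
      · simp only [C', hx, hy, if_false]
        refine hJ x y ?_
        tauto
  · have aux : ∀ x y z w, (NodeQuery.contract G u v).Adj x y →
        (NodeQuery.contract G u v).Adj z w → x ≠ z → x ≠ w → y ≠ z → y ≠ w →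
        z ≠ u → w ≠ u → Disjoint (C' x y) (C' z w) := by
      rintro x y z w ⟨hxy, hxv, hyv, h⟩ ⟨hzw, hzv, hwv, h'⟩ h1 h2 h3 h4 hz hw
      have hzw' : G.Adj z w := by tauto
      simp only [C', hz, hw, if_false]
      by_cases hx : x = u
      · subst hx
        simp only [if_true]
        refine hKD y z w ?_ hzw' h1 h2 hzv.symm hwv.symm h3 h4
        rcases h with h | h | h
        · exact Or.inl h
        · exact Or.inr h.2
        · exact absurd h.1.symm hxy
      · by_cases hy : y = u
        · subst hy
          simp only [hx, if_true, if_false]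
          refine hKD x z w ?_ hzw' h3 h4 hzv.symm hwv.symm h1 h2
          rcases h with h | h | h
          · exact Or.inl h.symm
          · exact absurd h.1 hx
          · exact Or.inr h.2
        · simp only [hx, hy, if_false]
          refine hD x y z w ?_ hzw' h1 h2 h3 h4
          tauto
    intro x y z w hxy hzw h1 h2 h3 h4
    by_cases hz : z = u
    · subst hz
      exact (aux z w x y hzw hxy h1.symm h3.symm h2.symm h4.symm h1 h3).symm
    · by_cases hw : w = u
      · subst hw
        exact (aux z w x y hzw hxy h1.symm h3.symm h2.symm h4.symm h2 h4).symm
      · exact aux x y z w hxy hzw h1 h2 h3 h4 hz hw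

lemma WeaklyDrawable.not_clique_fin_five (hG : WeaklyDrawable G) (f : Fin 5 → V)
    (hf : ∀ i j, i < j → G.Adj (f i) (f j)) : False := by
  obtain ⟨p, C, hJ, hD⟩ := hG
  have hne : ∀ i j, i ≠ j → f i ≠ f j := fun i j hij =>
    (lt_or_gt_of_ne hij).elim (fun h => (hf i j h).ne) (fun h => (hf j i h).ne')
  exact not_joinedIn_fin_five (fun i => p (f i)) (fun i j => C (f i) (f j))
    (fun i j hij => hJ _ _ (hf i j hij))
    (fun i j k l hij hkl h1 h2 h3 h4 => hD _ _ _ _ (hf i j hij) (hf k l hkl)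
      (hne _ _ h1) (hne _ _ h2) (hne _ _ h3) (hne _ _ h4))

end

/-! ### The edge bound -/

section

open Finset

variable {V : Type*} [Fintype V] [DecidableEq V]

open Classical in
/-- Contracting an edge destroys that edge and one edge for each triangle on it. -/
lemma card_edgeFinset_le_contract (G : SimpleGraph V) {u v : V} (huv : G.Adj u v) :
    #G.edgeFinset ≤
      #(contract G u v).edgeFinset + 1 + #(G.neighborFinset u ∩ G.neighborFinset v) := by
  set N := (G.neighborFinset v \ G.neighborFinset u).erase u with hN
  have hNcard : G.degree v = #N + 1 + #(G.neighborFinset u ∩ G.neighborFinset v) := by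
    rw [hN, card_erase_of_mem (by simp [huv.symm]), ← G.card_neighborFinset_eq_degree v,
      ← card_sdiff_add_card_inter (G.neighborFinset v) (G.neighborFinset u),
      inter_comm (G.neighborFinset v)]
    have : 0 < #(G.neighborFinset v \ G.neighborFinset u) :=
      card_pos.2 ⟨u, by simp [huv.symm]⟩
    omega
  have hinc : G.incidenceFinset v ⊆ G.edgeFinset := by
    simp [SimpleGraph.incidenceFinset, G.incidenceSet_subset]
  have hsub : (G.edgeFinset \ G.incidenceFinset v) ∪ N.image (fun y => s(u, y)) ⊆
      (contract G u v).edgeFinset := by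
    intro e he
    induction e with | _ x y
    rw [mem_union] at he
    rw [SimpleGraph.mem_edgeFinset, SimpleGraph.mem_edgeSet]
    rcases he with he | he
    · simp only [Finset.mem_sdiff, SimpleGraph.mem_edgeFinset, SimpleGraph.mem_edgeSet,
        SimpleGraph.mem_incidenceFinset, SimpleGraph.mk'_mem_incidenceSet_iff] at he
      refine ⟨he.1.ne, ?_, ?_, Or.inl he.1⟩
      · rintro rfl; exact he.2 ⟨he.1, Or.inl rfl⟩
      · rintro rfl; exact he.2 ⟨he.1, Or.inr rfl⟩
    · obtain ⟨z, hz, hzxy⟩ := mem_image.1 he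
      simp only [hN, mem_erase, Finset.mem_sdiff, SimpleGraph.mem_neighborFinset] at hz
      rw [← SimpleGraph.mem_edgeSet, ← hzxy, SimpleGraph.mem_edgeSet]
      exact ⟨hz.1.symm, huv.ne, hz.2.1.ne', Or.inr (Or.inl ⟨rfl, hz.2.1⟩)⟩
  have hdisj : Disjoint (G.edgeFinset \ G.incidenceFinset v) (N.image (fun y => s(u, y))) := by
    rw [disjoint_left]
    intro e he he'
    obtain ⟨z, hz, rfl⟩ := mem_image.1 he'
    simp only [hN, mem_erase, Finset.mem_sdiff, SimpleGraph.mem_neighborFinset] at hz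
    simp only [Finset.mem_sdiff, SimpleGraph.mem_edgeFinset, SimpleGraph.mem_edgeSet] at he
    exact hz.2.2 he.1
  have h := card_le_card hsub
  rw [card_union_of_disjoint hdisj, card_sdiff_of_subset hinc,
    SimpleGraph.card_incidenceFinset_eq_degree,
    card_image_of_injective _ (fun a b hab => Sym2.congr_right.1 hab)] at h
  omega

open Classical in
/-- If each edge at a vertex of degree one to five lies in at least three triangles, then this
vertex and its neighbours contain a complete graph on five vertices, possibly after the contraction
of an edge. -/
lemma not_weaklyDrawable_of_triangles {G : SimpleGraph V} {v : V} (h0 : 0 < G.degree v)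
    (h5 : G.degree v ≤ 5)
    (ht : ∀ u, G.Adj v u → 3 ≤ #(G.neighborFinset u ∩ G.neighborFinset v)) :
    ¬ WeaklyDrawable G := by
  intro hG
  set N := G.neighborFinset v with hN
  have hNcard : #N = G.degree v := G.card_neighborFinset_eq_degree v
  have hmem : ∀ x, x ∈ N ↔ G.Adj v x := fun x => G.mem_neighborFinset v x
  have hsub : ∀ u, G.neighborFinset u ∩ N ⊆ N.erase u := fun u x hx => by
    simp only [mem_inter, SimpleGraph.mem_neighborFinset] at hx
    exact mem_erase.2 ⟨hx.1.ne', hx.2⟩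
  -- Inside the neighbourhood, a vertex misses at most one other vertex.
  have hmiss : ∀ u x y, u ∈ N → x ∈ N → y ∈ N → x ≠ u → y ≠ u → x ≠ y → ¬ G.Adj u x →
      G.Adj u y := by
    intro u x y hu hx hy hxu hyu hxy hux
    by_contra huy
    have h1 : G.neighborFinset u ∩ N ⊆ ((N.erase u).erase x).erase y := fun z hz => by
      have := hsub u hz
      simp only [mem_inter, SimpleGraph.mem_neighborFinset] at hz
      refine mem_erase.2 ⟨?_, mem_erase.2 ⟨?_, this⟩⟩
      · rintro rfl; exact huy hz.1
      · rintro rfl; exact hux hz.1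
    have h2 := card_le_card h1
    rw [card_erase_of_mem (by simp [hxy.symm, hyu, hy]), card_erase_of_mem (by simp [hxu, hx]),
      card_erase_of_mem hu] at h2
    have := ht u ((hmem u).1 hu)
    omega
  have hfin : ∀ {H : SimpleGraph V} {a c d e : V}, WeaklyDrawable H →
      H.Adj v a → H.Adj v c → H.Adj v d → H.Adj v e → H.Adj a c → H.Adj a d → H.Adj a e →
      H.Adj c d → H.Adj c e → H.Adj d e → False := by
    intro H a c d e hH h1 h2 h3 h4 h5 h6 h7 h8 h9 h10
    refine hH.not_clique_fin_five ![v, a, c, d, e] ?_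
    intro i j hij
    fin_cases i <;> fin_cases j <;> first | assumption | (exact absurd hij (by decide))
  by_cases hcl : ∀ x ∈ N, ∀ y ∈ N, x ≠ y → G.Adj x y
  · obtain ⟨a, ha⟩ : N.Nonempty := card_pos.1 (by omega)
    have h3 : 3 ≤ #(N.erase a) := (ht a ((hmem a).1 ha)).trans (card_le_card (hsub a))
    obtain ⟨T, hT, hTc⟩ := exists_subset_card_eq h3
    obtain ⟨c, d, e, hcd, hce, hde, rfl⟩ := card_eq_three.1 hTc
    obtain ⟨hca, hc⟩ := mem_erase.1 (hT (by simp : c ∈ _))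
    obtain ⟨hda, hd⟩ := mem_erase.1 (hT (by simp : d ∈ _))
    obtain ⟨hea, he⟩ := mem_erase.1 (hT (by simp : e ∈ _))
    exact hfin hG ((hmem _).1 ha) ((hmem _).1 hc) ((hmem _).1 hd) ((hmem _).1 he)
      (hcl _ ha _ hc hca.symm) (hcl _ ha _ hd hda.symm) (hcl _ ha _ he hea.symm)
      (hcl _ hc _ hd hcd) (hcl _ hc _ he hce) (hcl _ hd _ he hde)
  · push Not at hcl
    obtain ⟨a, ha, b, hb, hab, hnab⟩ := hcl
    have hnba : ¬ G.Adj b a := fun h => hnab h.symm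
    have hcard : #((N.erase a).erase b) = 3 := by
      have h1 : G.neighborFinset a ∩ N ⊆ (N.erase a).erase b := fun z hz => by
        refine mem_erase.2 ⟨?_, hsub a hz⟩
        rintro rfl
        exact hnab ((G.mem_neighborFinset _ _).1 (mem_inter.1 hz).1)
      have h2 := card_le_card h1
      have h3 := ht a ((hmem a).1 ha)
      rw [card_erase_of_mem (by simp [hab.symm, hb]), card_erase_of_mem ha] at h2 ⊢
      omega
    obtain ⟨c, d, e, hcd, hce, hde, hT⟩ := card_eq_three.1 hcard
    have hin : ∀ x ∈ ({c, d, e} : Finset V), x ∈ N ∧ G.Adj a x ∧ G.Adj b x ∧ x ≠ b := by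
      intro x hx
      rw [← hT, mem_erase, mem_erase] at hx
      obtain ⟨hxb, hxa, hxN⟩ := hx
      exact ⟨hxN, hmiss a b x ha hb hxN hab.symm hxa hxb.symm hnab,
        hmiss b a x hb ha hxN hab hxb hxa.symm hnba, hxb⟩
    -- The path through `b` replaces the only edge that may be missing.
    have hcontr : ∀ c d e, d ≠ e → (c ∈ N ∧ G.Adj a c ∧ G.Adj b c ∧ c ≠ b) →
        (d ∈ N ∧ G.Adj a d ∧ G.Adj b d ∧ d ≠ b) → (e ∈ N ∧ G.Adj a e ∧ G.Adj b e ∧ e ≠ b) →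
        G.Adj c d → G.Adj c e → False := by
      rintro c d e hde ⟨hc, hac, hbc, hcb⟩ ⟨hd, had, hbd, hdb⟩ ⟨he, hae, hbe, heb⟩ h1 h2
      have hvb : v ≠ b := ((hmem b).1 hb).ne
      have keep : ∀ {x y}, G.Adj x y → x ≠ b → y ≠ b → (contract G d b).Adj x y :=
        fun h hx hy => ⟨h.ne, hx, hy, Or.inl h⟩
      exact hfin (hG.contract hbd.symm) (keep ((hmem _).1 ha) hvb hab)
        (keep ((hmem _).1 hc) hvb hcb) (keep ((hmem _).1 hd) hvb hdb)
        (keep ((hmem _).1 he) hvb heb) (keep hac hab hcb) (keep had hab hdb) (keep hae hab heb)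
        (keep h1 hcb hdb) (keep h2 hcb heb) ⟨hde, hdb, heb, Or.inr (Or.inl ⟨rfl, hbe⟩)⟩
    have Hc := hin c (by simp)
    have Hd := hin d (by simp)
    have He := hin e (by simp)
    by_cases h1 : G.Adj c d
    · by_cases h2 : G.Adj c e
      · exact hcontr c d e hde Hc Hd He h1 h2
      · exact hcontr d c e hce Hd Hc He h1.symm
          (hmiss e c d He.1 Hc.1 Hd.1 hce hde hcd fun h => h2 h.symm).symm
    · exact hcontr e c d hcd He Hc Hd
        (hmiss c d e Hc.1 Hd.1 He.1 hcd.symm hce.symm hde h1).symm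
        (hmiss d c e Hd.1 Hc.1 He.1 hcd hde.symm hce fun h => h1 h.symm).symm

open Classical in
/-- A weakly drawable graph on `n > 0` vertices has fewer than `3 n - 1` edges. In a
counterexample with the least number of vertices and exactly `3 n - 1` edges every edge lies in
three triangles, as it could be contracted otherwise, and some vertex has degree at most five. -/
theorem WeaklyDrawable.card_edgeFinset_lt {G : SimpleGraph V} (hG : WeaklyDrawable G)
    {s : Finset V} (hs : s.Nonempty) (hGs : ∀ x y, G.Adj x y → x ∈ s) :
    #G.edgeFinset + 1 < 3 * #s := by
  induction hn : #s using Nat.strong_induction_on generalizing G s with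
  | _ n ih =>
    subst hn
    by_contra! hlt
    obtain ⟨H, hHG, hHc⟩ : ∃ H ≤ G, #H.edgeFinset = 3 * #s - 1 := by
      obtain ⟨T, hT, hTc⟩ := exists_subset_card_eq (show 3 * #s - 1 ≤ #G.edgeFinset by omega)
      refine ⟨SimpleGraph.fromEdgeSet (T : Set (Sym2 V)), fun x y hxy => ?_, ?_⟩
      · rw [SimpleGraph.fromEdgeSet_adj] at hxy
        simpa using hT hxy.1
      · rw [← hTc]
        congr 1
        ext e
        simp only [SimpleGraph.edgeFinset, Set.mem_toFinset, SimpleGraph.edgeSet_fromEdgeSet,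
          Set.mem_sdiff, mem_coe, and_iff_left_iff_imp]
        exact fun he => G.not_isDiag_of_mem_edgeSet (SimpleGraph.mem_edgeFinset.1 (hT he))
    have hHW : WeaklyDrawable H := hG.mono hHG
    have hHs : ∀ x y, H.Adj x y → x ∈ s := fun x y hxy => hGs x y (hHG hxy)
    have hpos : 0 < #s := card_pos.2 hs
    obtain ⟨v, hv, hv5⟩ : ∃ v ∈ s, H.degree v ≤ 5 := by
      by_contra! hdeg
      have h1 : #s * 6 ≤ ∑ v ∈ s, H.degree v := by
        simpa using card_nsmul_le_sum s (fun v => H.degree v) 6 fun v hv => hdeg v hv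
      have h2 : ∑ v ∈ s, H.degree v ≤ ∑ v, H.degree v :=
        sum_le_sum_of_subset (subset_univ s)
      rw [H.sum_degrees_eq_twice_card_edges] at h2
      omega
    have hcard : #(s.erase v) = #s - 1 := card_erase_of_mem hv
    rcases Nat.eq_zero_or_pos (H.degree v) with h0 | h0
    · have hiso : ∀ y, ¬ H.Adj v y := fun y hy => by
        rw [← H.card_neighborFinset_eq_degree, card_eq_zero] at h0
        have : y ∈ H.neighborFinset v := by simpa using hy
        simp [h0] at this
      have hGs' : ∀ x y, H.Adj x y → x ∈ s.erase v := fun x y hxy =>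
        mem_erase.2 ⟨by rintro rfl; exact hiso y hxy, hHs x y hxy⟩
      rcases (s.erase v).eq_empty_or_nonempty with hemp | hne
      · have : H.edgeFinset = ∅ := by
          refine eq_empty_of_forall_notMem fun e he => ?_
          induction e with | _ x y
          have := hGs' x y (by simpa using he)
          simp [hemp] at this
        rw [this, card_empty] at hHc
        omega
      · have := ih _ (by omega) hHW hne hGs' rfl
        omega
    · refine not_weaklyDrawable_of_triangles h0 hv5 (fun u hvu => ?_) hHW
      by_contra! htri
      have h1 := card_edgeFinset_le_contract H hvu.symm
      have hus : u ∈ s.erase v := mem_erase.2 ⟨hvu.ne', hHs u v hvu.symm⟩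
      have h2 := ih _ (by omega) (hHW.contract hvu.symm) ⟨u, hus⟩
        (fun x y hxy => mem_erase.2 ⟨hxy.2.1, by
          rcases hxy.2.2.2 with h | h | h
          · exact hHs x y h
          · exact h.1 ▸ (mem_erase.1 hus).2
          · exact hHs x v h.2.symm⟩) rfl
      omega

end

/-! ### Plane embeddings -/

section

variable {V W : Type u} {G : SimpleGraph V} {H : SimpleGraph W}

lemma PlaneEmbedding.weaklyDrawable (E : PlaneEmbedding G) : WeaklyDrawable G := by
  let φ := Complex.orthonormalBasisOneI.repr.symm
  let C : V → V → Set (EuclideanSpace ℝ (Fin 2)) := fun x y =>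
    {q | ∃ h : s(x, y) ∈ G.edgeSet, q ∈ Set.range (E.arc ⟨s(x, y), h⟩)}
  refine ⟨fun x => φ (E.point x), fun x y => φ '' C x y, fun x y hxy => ?_, ?_⟩
  · refine JoinedIn.map (?_ : JoinedIn (C x y) (E.point x) (E.point y)) φ.continuous
    obtain ⟨v, w, hvw, h0, h1⟩ := E.arc_ends ⟨s(x, y), hxy⟩
    have hJ : JoinedIn (C x y) (E.point v) (E.point w) :=
      ⟨⟨E.arc ⟨s(x, y), hxy⟩, h0, h1⟩, fun t => ⟨hxy, t, rfl⟩⟩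
    rcases Sym2.eq_iff.1 hvw with ⟨rfl, rfl⟩ | ⟨rfl, rfl⟩
    · exact hJ
    · exact hJ.symm
  · intro x y z w hxy hzw h1 h2 h3 h4
    rw [Set.disjoint_image_iff φ.injective, Set.disjoint_left]
    rintro q ⟨hxy', s, rfl⟩ ⟨hzw', t, hst⟩
    have hne : (⟨s(x, y), hxy'⟩ : G.edgeSet) ≠ ⟨s(z, w), hzw'⟩ := by
      intro h
      rcases Sym2.eq_iff.1 (Subtype.ext_iff.1 h) with h | h
      · exact h1 h.1
      · exact h2 h.1
    -- A common point is an end of both arcs, hence a common vertex.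
    obtain ⟨a, b, hab, ha, hb⟩ := E.arc_ends ⟨s(x, y), hxy'⟩
    obtain ⟨c, d, hcd, hc, hd⟩ := E.arc_ends ⟨s(z, w), hzw'⟩
    obtain ⟨i, hi, hip⟩ : ∃ i, (i = x ∨ i = y) ∧ E.arc ⟨s(x, y), hxy'⟩ s = E.point i := by
      have hab' := Sym2.eq_iff.1 hab
      rcases E.arcs_disjoint _ _ hne s t hst.symm with rfl | rfl
      · exact ⟨a, by tauto, ha⟩
      · exact ⟨b, by tauto, hb⟩
    obtain ⟨j, hj, hjp⟩ : ∃ j, (j = z ∨ j = w) ∧ E.arc ⟨s(z, w), hzw'⟩ t = E.point j := by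
      have hcd' := Sym2.eq_iff.1 hcd
      rcases E.arc_avoids_points _ t i (hst.trans hip) with rfl | rfl
      · exact ⟨c, by tauto, hc⟩
      · exact ⟨d, by tauto, hd⟩
    have hij : i = j := E.point_injective (by rw [← hip, ← hjp, hst])
    rcases hi with rfl | rfl <;> rcases hj with rfl | rfl <;> contradiction

/-- A plane embedding of `H` restricts to every graph that embeds in `H`. -/
def PlaneEmbedding.comap (E : PlaneEmbedding H) (f : G ↪g H) : PlaneEmbedding G where
  point v := E.point (f v)
  point_injective := E.point_injective.comp f.injective
  arc e := E.arc (f.mapEdgeSet e)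
  arc_injective e := E.arc_injective _
  arc_ends e := by
    obtain ⟨e, he⟩ := e
    induction e with | _ x y
    obtain ⟨v, w, hvw, h0, h1⟩ := E.arc_ends (f.mapEdgeSet ⟨s(x, y), he⟩)
    have hvw' : s(f x, f y) = s(v, w) := hvw
    rcases Sym2.eq_iff.1 hvw' with ⟨rfl, rfl⟩ | ⟨rfl, rfl⟩
    · exact ⟨x, y, rfl, h0, h1⟩
    · exact ⟨y, x, Sym2.eq_swap, h0, h1⟩
  arc_avoids_points e t v h := E.arc_avoids_points _ t _ h
  arcs_disjoint e e' hne s t h := E.arcs_disjoint _ _ (f.mapEdgeSet.injective.ne hne) s t h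

lemma inducedSatisfies_planarity_empty (G : SimpleGraph V) :
    InducedSatisfies planarity G ∅ :=
  have : IsEmpty (G.induce (∅ : Set V)).edgeSet :=
    ⟨fun ⟨e, _⟩ => by induction e with | _ x y => exact x.2⟩
  ⟨{point := fun v => v.2.elim
    point_injective := fun v => v.2.elim
    arc := isEmptyElim
    arc_injective := isEmptyElim
    arc_ends := isEmptyElim
    arc_avoids_points := isEmptyElim
    arcs_disjoint := isEmptyElim}⟩

lemma InducedSatisfies.image {S : Set V} (h : InducedSatisfies planarity G S) (φ : G ≃g H) :
    InducedSatisfies planarity H (φ '' S) := by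
  obtain ⟨E⟩ := h
  have hmem : ∀ w : φ '' S, φ.symm w ∈ S := by
    rintro ⟨w, v, hv, rfl⟩
    simpa using hv
  exact ⟨E.comap
    { toFun := fun w => ⟨φ.symm w, hmem w⟩
      inj' := fun w w' hww => Subtype.ext (φ.symm.injective (Subtype.ext_iff.1 hww))
      map_rel_iff' := fun {w w'} => φ.symm.map_adj_iff }⟩

/-- Some maximal vertex set induces a planar graph. -/
lemma exists_maximal_planar [Finite V] (G : SimpleGraph V) :
    ∃ S : Set V, InducedSatisfies planarity G S ∧
      ∀ i ∉ S, ¬ InducedSatisfies planarity G (insert i S) := by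
  obtain ⟨S, hS⟩ := (Set.toFinite {S : Set V | InducedSatisfies planarity G S}).exists_maximal
    ⟨∅, inducedSatisfies_planarity_empty G⟩
  exact ⟨S, hS.1, fun i hi h => hi (hS.2 h (Set.subset_insert i S) (Set.mem_insert i S))⟩

end

/-! ### Vertex-transitive graphs of degree at least seven -/

section

open Finset

variable {V : Type u} {G : SimpleGraph V}

lemma IsVertexTransitive.ncard_neighborSet_eq (hG : IsVertexTransitive G) (v w : V) :
    (G.neighborSet v).ncard = (G.neighborSet w).ncard := by
  obtain ⟨φ, rfl⟩ := hG v w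
  have : G.neighborSet (φ v) = φ '' G.neighborSet v := by
    ext x
    constructor
    · intro hx
      exact ⟨φ.symm x, by simpa using φ.symm.map_adj_iff.2 hx, by simp⟩
    · rintro ⟨y, hy, rfl⟩
      exact φ.map_adj_iff.2 hy
  rw [this, Set.ncard_image_of_injective _ φ.injective]

variable [Finite V]

/-- A set that induces a planar subgraph misses at least one eighth of the vertices. If `G` is
`d`-regular on `n` vertices and the set misses `k` of them, then the degrees in the induced subgraph
sum to at least `d (n - k) - d k`, and at most to `6 (n - k)` by planarity. -/
lemma card_le_eight_mul_ncard_compl (hG : transitiveOfDegreeAtLeast 7 V G) {S : Set V}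
    (hS : InducedSatisfies planarity G S) : Nat.card V ≤ 8 * Sᶜ.ncard := by
  classical
  have := Fintype.ofFinite V
  rcases S.eq_empty_or_nonempty with rfl | ⟨v₀, hv₀⟩
  · rw [Set.compl_empty, Set.ncard_univ]; omega
  obtain ⟨htr, h7⟩ := hG
  obtain ⟨d, hd⟩ : ∃ d, d = (G.neighborSet v₀).ncard := ⟨_, rfl⟩
  have hdeg : ∀ v, G.degree v = d := fun v => by
    rw [hd, htr.ncard_neighborSet_eq v₀ v, Set.ncard_eq_toFinset_card',
      ← G.card_neighborFinset_eq_degree]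
    rfl
  have hd7 : 7 ≤ d := hd ▸ h7 v₀
  obtain ⟨E⟩ := hS
  set T := S.toFinset with hT
  -- The planar graph `G[S]`, extended by isolated vertices.
  set H : SimpleGraph S := G.induce S with hH
  have hE : #H.edgeFinset + 1 < 3 * #(univ : Finset S) := by
    convert! E.weaklyDrawable.card_edgeFinset_lt (s := univ) ⟨⟨v₀, hv₀⟩, mem_univ _⟩
      (fun _ _ _ => mem_univ _)
  have hsum : ∑ x : S, H.degree x = 2 * #H.edgeFinset := H.sum_degrees_eq_twice_card_edges
  have hHdeg : ∀ x : S, H.degree x = #(G.neighborFinset x ∩ T) := by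
    intro x
    rw [← H.card_neighborFinset_eq_degree]
    refine card_bij (fun y _ => y) (fun y hy => ?_) (fun y _ z _ h => Subtype.ext h)
      (fun y hy => ?_)
    · rw [SimpleGraph.mem_neighborFinset] at hy
      exact mem_inter.2 ⟨by simpa [hH] using hy, by simp [hT]⟩
    · rw [mem_inter, SimpleGraph.mem_neighborFinset, hT, Set.mem_toFinset] at hy
      exact ⟨⟨y, hy.2⟩, by simpa [hH] using hy.1, rfl⟩
  have hsplit : ∀ v, #(G.neighborFinset v ∩ T) + #(G.neighborFinset v ∩ Tᶜ) = d := by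
    intro v
    rw [← hdeg v, ← G.card_neighborFinset_eq_degree v,
      ← card_inter_add_card_sdiff (G.neighborFinset v) T, sdiff_eq_inter_compl]
  have hsumT : ∑ x : S, H.degree x = ∑ v ∈ T, #(G.neighborFinset v ∩ T) := by
    rw [sum_congr rfl fun x _ => hHdeg x]
    exact (sum_subtype T (fun x => by simp [hT]) fun v => #(G.neighborFinset v ∩ T)).symm
  have hcross : ∑ v ∈ T, #(G.neighborFinset v ∩ Tᶜ) ≤ d * #Tᶜ := by
    have h1 : ∑ v ∈ T, #(G.neighborFinset v ∩ Tᶜ) = ∑ w ∈ Tᶜ, #(G.neighborFinset w ∩ T) := by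
      convert sum_card_bipartiteAbove_eq_sum_card_bipartiteBelow (s := T) (t := Tᶜ) G.Adj
        using 3 with v _ w _
      · ext x; simp [bipartiteAbove, and_comm]
      · ext x; simp [bipartiteBelow, and_comm, G.adj_comm]
    rw [h1, mul_comm, ← smul_eq_mul]
    refine sum_le_card_nsmul _ _ _ fun w _ => ?_
    rw [← hsplit w]
    exact Nat.le_add_right _ _
  have htot : ∑ v ∈ T, #(G.neighborFinset v ∩ T) + ∑ v ∈ T, #(G.neighborFinset v ∩ Tᶜ)
      = d * #T := by
    rw [← sum_add_distrib, sum_congr rfl fun v _ => hsplit v, sum_const, smul_eq_mul, mul_comm]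
  have hTcard : #(univ : Finset S) = #T := by simp [hT]
  have hTc : Sᶜ.ncard = #Tᶜ := by
    rw [Set.ncard_eq_toFinset_card', Set.toFinset_compl]
  have hVc : Nat.card V = #T + #Tᶜ := by
    rw [card_add_card_compl, Nat.card_eq_fintype_card]
  rw [hTcard] at hE
  rw [hTc, hVc]
  have hfin : d * #T ≤ 6 * #T + d * #Tᶜ := by omega
  obtain ⟨e, rfl⟩ := Nat.exists_eq_add_of_le hd7
  by_contra! hlt
  have := Nat.mul_le_mul_left e (show #Tᶜ ≤ #T by omega)
  nlinarith

/-- Vertex-transitive graphs of degree at least seven are relevant for planarity: an automorphism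
moves a maximal planar vertex set away from any given vertex. -/
lemma isRelevant_of_transitiveOfDegreeAtLeast (hG : transitiveOfDegreeAtLeast 7 V G) :
    IsRelevant planarity G := by
  intro i
  obtain ⟨S, hS, hmax⟩ := exists_maximal_planar G
  obtain ⟨j, hj⟩ : Sᶜ.Nonempty := by
    have h1 := card_le_eight_mul_ncard_compl hG hS
    have : Nonempty V := ⟨i⟩
    have h2 : 0 < Nat.card V := Nat.card_pos
    exact (Set.ncard_pos (Set.toFinite _)).1 (by omega)
  obtain ⟨φ, rfl⟩ := hG.1 j i
  have hni : φ j ∉ φ '' S := fun h => hj (φ.injective.mem_set_image.1 h)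
  refine ⟨insert (φ j) (φ '' S), Set.mem_insert _ _, Or.inr ⟨?_, fun h => hmax j hj ?_⟩⟩
  · rw [Set.insert_sdiff_self_of_notMem hni]
    exact hS.image φ
  · rw [← Set.image_insert_eq] at h
    have := h.image φ.symm
    rwa [Set.image_image, Set.image_congr fun x _ => φ.symm_apply_apply x, Set.image_id'] at this

lemma transitiveOfDegreeAtLeast_top {d : ℕ} (h : d < Nat.card V) :
    transitiveOfDegreeAtLeast d V (⊤ : SimpleGraph V) := by
  classical
  refine ⟨fun v w => ⟨SimpleGraph.Iso.completeGraph (Equiv.swap v w),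
    Equiv.swap_apply_left v w⟩, fun v => ?_⟩
  have : (⊤ : SimpleGraph V).neighborSet v = {v}ᶜ := by ext; simp [eq_comm]
  rw [this, Set.ncard_compl, Set.ncard_singleton]
  omega

end

/-! ### Query complexity and sensitivity -/

section

open Finset

variable {V : Type u} [DecidableEq V]

/-- The set of variables that the tree queries on the input `x`. -/
def DecisionTree.queried : DecisionTree V → (V → Bool) → Finset V
  | leaf _, _ => ∅
  | query i no yes, x => insert i (if x i then yes.queried x else no.queried x)

lemma DecisionTree.card_queried_le_cost (T : DecisionTree V) (x : V → Bool) :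
    #(T.queried x) ≤ T.cost x := by
  induction T with
  | leaf b => simp [queried]
  | query i no yes hno hyes =>
    simp only [queried, cost]
    refine (card_insert_le _ _).trans ?_
    split_ifs <;> omega

omit [DecidableEq V] in
lemma DecisionTree.cost_le_depth (T : DecisionTree V) (x : V → Bool) : T.cost x ≤ T.depth := by
  induction T with
  | leaf b => simp [cost]
  | query i no yes hno hyes =>
    simp only [cost, depth]
    split_ifs <;> omega

lemma DecisionTree.eval_congr (T : DecisionTree V) {x y : V → Bool}
    (h : ∀ i ∈ T.queried x, x i = y i) : T.eval x = T.eval y := by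
  induction T with
  | leaf b => rfl
  | query i no yes hno hyes =>
    simp only [queried, mem_insert, forall_eq_or_imp] at h
    obtain ⟨hi, h⟩ := h
    simp only [eval, ← hi]
    split_ifs with hx
    · exact hyes fun j hj => h j (by simpa [hx] using hj)
    · exact hno fun j hj => h j (by simpa [hx] using hj)

lemma exists_decisionTree_depth_le (s : Finset V) (f : (V → Bool) → Bool)
    (hf : ∀ x y, (∀ i ∈ s, x i = y i) → f x = f y) :
    ∃ T : DecisionTree V, (∀ x, T.eval x = f x) ∧ T.depth ≤ #s := by
  induction s using Finset.induction_on generalizing f with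
  | empty =>
    exact ⟨.leaf (f fun _ => false), fun x => hf _ _ (by simp), by simp [DecisionTree.depth]⟩
  | insert a s ha ih =>
    have hstep : ∀ b, ∃ T : DecisionTree V,
        (∀ x, T.eval x = f (Function.update x a b)) ∧ T.depth ≤ #s := fun b =>
      ih (fun x => f (Function.update x a b)) fun x y hxy => hf _ _ fun i hi => by
        by_cases hia : i = a
        · subst hia; simp
        · simpa [hia] using hxy i ((mem_insert.1 hi).resolve_left hia)
    obtain ⟨T₀, h₀, d₀⟩ := hstep false
    obtain ⟨T₁, h₁, d₁⟩ := hstep true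
    refine ⟨.query a T₀ T₁, fun x => ?_, ?_⟩
    · simp only [DecisionTree.eval, h₀, h₁]
      split_ifs with hx
      · rw [← hx, Function.update_eq_self]
      · rw [← Bool.eq_false_of_not_eq_true hx, Function.update_eq_self]
    · rw [DecisionTree.depth, card_insert_of_notMem ha]
      omega

/-- A tree that gives different answers on `x` and on `x` with the entry `i` flipped must
query `i` on the input `x`. -/
lemma DecisionTree.mem_queried_of_eval_ne (T : DecisionTree V) {x : V → Bool} {i : V} {b : Bool}
    (h : T.eval (Function.update x i b) ≠ T.eval x) : i ∈ T.queried x := by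
  by_contra hi
  refine h (T.eval_congr fun j hj => ?_).symm
  rw [Function.update_of_ne]
  rintro rfl
  exact hi hj

end

section

open Finset

variable {V : Type u}

lemma exists_decisionTree_depth_le_card [Finite V] (f : (V → Bool) → Bool) :
    ∃ T : DecisionTree V, (∀ x, T.eval x = f x) ∧ T.depth ≤ Nat.card V := by
  classical
  have := Fintype.ofFinite V
  obtain ⟨T, hT, hd⟩ := exists_decisionTree_depth_le univ f
    (fun x y h => by rw [funext fun i => h i (mem_univ i)])
  exact ⟨T, hT, by rwa [Nat.card_eq_fintype_card]⟩

lemma detComplexity_mem [Finite V] (f : (V → Bool) → Bool) :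
    ∃ T : DecisionTree V, (∀ x, T.eval x = f x) ∧ ∀ x, T.cost x ≤ detComplexity f := by
  obtain ⟨T, hT, hd⟩ := exists_decisionTree_depth_le_card f
  exact Nat.sInf_mem
    (s := {k | ∃ T : DecisionTree V, (∀ x, T.eval x = f x) ∧ ∀ x, T.cost x ≤ k})
    ⟨_, T, hT, fun x => (T.cost_le_depth x).trans hd⟩

lemma detComplexity_le_card [Finite V] (f : (V → Bool) → Bool) :
    detComplexity f ≤ Nat.card V := by
  obtain ⟨T, hT, hd⟩ := exists_decisionTree_depth_le_card f
  exact Nat.sInf_le ⟨T, hT, fun x => (T.cost_le_depth x).trans hd⟩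

lemma exists_pmf_depth_le_card [Finite V] (f : (V → Bool) → Bool) :
    ∃ μ : PMF (DecisionTree V),
      (∀ x, (2 / 3 : ENNReal) ≤ μ.toOuterMeasure {T | T.eval x = f x}) ∧
        ∀ T ∈ μ.support, T.depth ≤ Nat.card V := by
  obtain ⟨T, hT, hd⟩ := exists_decisionTree_depth_le_card f
  refine ⟨PMF.pure T, fun x => ?_, fun T' hT' => ?_⟩
  · rw [PMF.toOuterMeasure_pure_apply, if_pos (show T ∈ {T | T.eval x = f x} from hT x)]
    exact ENNReal.div_le_of_le_mul (by norm_num)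
  · rw [PMF.mem_support_pure_iff] at hT'
    exact hT' ▸ hd

lemma randComplexity_mem [Finite V] (f : (V → Bool) → Bool) :
    ∃ μ : PMF (DecisionTree V),
      (∀ x, (2 / 3 : ENNReal) ≤ μ.toOuterMeasure {T | T.eval x = f x}) ∧
        ∀ T ∈ μ.support, T.depth ≤ randComplexity f :=
  Nat.sInf_mem (s := {k | ∃ μ : PMF (DecisionTree V),
    (∀ x, (2 / 3 : ENNReal) ≤ μ.toOuterMeasure {T | T.eval x = f x}) ∧
      ∀ T ∈ μ.support, T.depth ≤ k}) ⟨_, exists_pmf_depth_le_card f⟩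

lemma randComplexity_le_card [Finite V] (f : (V → Bool) → Bool) :
    randComplexity f ≤ Nat.card V :=
  Nat.sInf_le (exists_pmf_depth_le_card f)

variable [Finite V] [DecidableEq V] {f : (V → Bool) → Bool} {x : V → Bool} {K : Finset V}

/-- Sensitivity bounds deterministic query complexity. -/
theorem card_le_detComplexity (hK : ∀ i ∈ K, f (Function.update x i (!x i)) ≠ f x) :
    #K ≤ detComplexity f := by
  obtain ⟨T, hT, hc⟩ := detComplexity_mem f
  exact (card_le_card fun i hi => T.mem_queried_of_eval_ne (by simpa [hT] using hK i hi)).trans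
    ((T.card_queried_le_cost x).trans (hc x))

/-- Sensitivity bounds randomized query complexity: with probability at least `1 / 3` the random
tree is right both on `x` and on `x` with a sensitive entry flipped, hence queries that entry. -/
theorem card_le_three_mul_randComplexity
    (hK : ∀ i ∈ K, f (Function.update x i (!x i)) ≠ f x) :
    #K ≤ 3 * randComplexity f := by
  obtain ⟨μ, hμ, hd⟩ := randComplexity_mem f
  let A : V → Set (DecisionTree V) := fun i => {T | i ∈ T.queried x}
  have hA : ∀ i ∈ K, (1 : ENNReal) ≤ 3 * ∑' T, (A i).indicator μ T := by
    intro i hi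
    have h1 := hμ x
    have h2 := hμ (Function.update x i (!x i))
    rw [PMF.toOuterMeasure_apply] at h1 h2
    have h3 := add_le_add h1 h2
    rw [← ENNReal.tsum_add] at h3
    have h4 := h3.trans (ENNReal.tsum_le_tsum (g := fun T => μ T + (A i).indicator μ T) ?_)
    · rw [ENNReal.tsum_add, μ.tsum_coe] at h4
      have h5 : (3 : ENNReal) + 1 ≤ 3 + 3 * ∑' T, (A i).indicator μ T := by
        calc (3 : ENNReal) + 1 = 3 * (2 / 3 + 2 / 3) := by
              rw [mul_add, ENNReal.mul_div_cancel (by norm_num) (by norm_num)]; norm_num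
          _ ≤ 3 * (1 + ∑' T, (A i).indicator μ T) := by gcongr
          _ = _ := by rw [mul_add, mul_one]
      exact (ENNReal.add_le_add_iff_left (by norm_num)).1 h5
    · intro T
      by_cases hTA : T ∈ A i
      · rw [Set.indicator_of_mem hTA]
        exact add_le_add (Set.indicator_le_self _ _ T) (Set.indicator_le_self _ _ T)
      · rw [Set.indicator_of_notMem hTA, add_zero]
        by_cases e1 : T.eval x = f x
        · have e2 : T ∉ {T : DecisionTree V | T.eval (Function.update x i (!x i)) =
              f (Function.update x i (!x i))} := fun e2 =>
            hTA (T.mem_queried_of_eval_ne (by rw [e1, e2]; exact hK i hi))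
          rw [Set.indicator_of_notMem e2, add_zero]
          exact Set.indicator_le_self _ _ T
        · rw [Set.indicator_of_notMem (show T ∉ {T : DecisionTree V | T.eval x = f x} from e1),
            zero_add]
          exact Set.indicator_le_self _ _ T
  have hsum : ∑ i ∈ K, ∑' T, (A i).indicator μ T ≤ randComplexity f := by
    rw [← Summable.tsum_finsetSum fun i _ => ENNReal.summable]
    calc ∑' T, ∑ i ∈ K, (A i).indicator μ T ≤ ∑' T, μ T * randComplexity f := by
          refine ENNReal.tsum_le_tsum fun T => ?_
          by_cases hT : μ T = 0
          · rw [sum_eq_zero fun i _ => ?_]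
            · exact zero_le
            · exact le_antisymm ((Set.indicator_le_self _ _ T).trans hT.le) (zero_le)
          · have : ∑ i ∈ K, (A i).indicator μ T = μ T * #(K ∩ T.queried x) := by
              rw [← filter_mem_eq_inter, mul_comm, ← nsmul_eq_mul, ← sum_const, sum_filter]
              refine sum_congr rfl fun i _ => ?_
              simp [A, Set.indicator_apply]
            rw [this]
            gcongr
            exact (card_le_card inter_subset_right).trans ((T.card_queried_le_cost x).trans
              ((T.cost_le_depth x).trans (hd T ((PMF.mem_support_iff _ _).2 hT))))
      _ = randComplexity f := by rw [ENNReal.tsum_mul_right, μ.tsum_coe, one_mul]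
  have : (#K : ENNReal) ≤ 3 * randComplexity f := by
    calc (#K : ENNReal) = ∑ i ∈ K, 1 := by simp
      _ ≤ ∑ i ∈ K, 3 * ∑' T, (A i).indicator μ T := sum_le_sum hA
      _ = 3 * ∑ i ∈ K, ∑' T, (A i).indicator μ T := by rw [mul_sum]
      _ ≤ _ := by gcongr
  exact_mod_cast this

end

/-! ### The cost of planarity -/

section

variable {V : Type u} [Finite V] {G : SimpleGraph V}

/-- Outside a maximal planar vertex set every vertex is sensitive. -/
lemma exists_sensitive_planarity (hG : transitiveOfDegreeAtLeast 7 V G) [DecidableEq V] :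
    ∃ (x : V → Bool) (K : Finset V), Nat.card V ≤ 8 * K.card ∧ ∀ i ∈ K,
      nodeFunction planarity G (Function.update x i (!x i)) ≠ nodeFunction planarity G x := by
  classical
  have := Fintype.ofFinite V
  obtain ⟨S, hS, hmax⟩ := exists_maximal_planar G
  refine ⟨fun v => decide (v ∈ S), Sᶜ.toFinset, ?_, fun i hi => ?_⟩
  · rw [← Set.ncard_eq_toFinset_card']
    exact card_le_eight_mul_ncard_compl hG hS
  · have hiS : i ∉ S := by simpa using hi
    have h1 : {v | decide (v ∈ S) = true} = S := by simp
    have h2 : {v | Function.update (fun v => decide (v ∈ S)) i (!decide (i ∈ S)) v = true} =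
        insert i S := by
      ext v
      by_cases hv : v = i
      · subst hv; simp [hiS]
      · simp [hv]
    simp only [nodeFunction, h1, h2]
    simp [hS, hmax i hiS]

lemma card_le_eight_mul_graphCost (hG : transitiveOfDegreeAtLeast 7 V G) :
    Nat.card V ≤ 8 * graphCost planarity G := by
  classical
  obtain ⟨x, K, hK, hs⟩ := exists_sensitive_planarity hG
  have := card_le_detComplexity hs
  rw [graphCost]
  omega

lemma card_le_mul_randGraphCost (hG : transitiveOfDegreeAtLeast 7 V G) :
    Nat.card V ≤ 24 * randGraphCost planarity G := by
  classical
  obtain ⟨x, K, hK, hs⟩ := exists_sensitive_planarity hG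
  have := card_le_three_mul_randComplexity hs
  rw [randGraphCost]
  omega

end

/-- Complete graphs show that for `n > 7` the minimum is over a nonempty set. -/
lemma minCost_planarity_bounds {n : ℕ} (hn : 7 < n) :
    n ≤ 8 * minCost (transitiveOfDegreeAtLeast.{u} 7) planarity.{u} n ∧
      minCost (transitiveOfDegreeAtLeast.{u} 7) planarity.{u} n ≤ n := by
  have hcard : Nat.card (ULift.{u} (Fin n)) = n := by simp
  have htop := transitiveOfDegreeAtLeast_top (V := ULift.{u} (Fin n)) (hcard.symm ▸ hn)
  have hmem : graphCost planarity (⊤ : SimpleGraph (ULift.{u} (Fin n))) ∈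
      {k | ∃ (V : Type u) (G : SimpleGraph V), Finite V ∧ Nat.card V = n ∧
        transitiveOfDegreeAtLeast 7 V G ∧ IsRelevant planarity G ∧ graphCost planarity G = k} :=
    ⟨_, _, inferInstance, hcard, htop, isRelevant_of_transitiveOfDegreeAtLeast htop, rfl⟩
  constructor
  · obtain ⟨V, G, _, hV, hG, -, hk⟩ := Nat.sInf_mem ⟨_, hmem⟩
    rw [minCost, ← hk, ← hV]
    exact card_le_eight_mul_graphCost hG
  · exact (Nat.sInf_le hmem).trans ((detComplexity_le_card _).trans hcard.le)

end NodeQuery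

theorem mainTheorem10 :
    (∃ c : ℝ, 0 < c ∧
      ∀ (V : Type u) [Finite V] (G : SimpleGraph V),
        NodeQuery.transitiveOfDegreeAtLeast 7 V G →
        NodeQuery.IsRelevant NodeQuery.planarity G →
        (c * (Nat.card V : ℝ) ≤ (NodeQuery.graphCost NodeQuery.planarity G : ℝ) ∧
          NodeQuery.graphCost NodeQuery.planarity G ≤ Nat.card V) ∧
        (c * (Nat.card V : ℝ) ≤ (NodeQuery.randGraphCost NodeQuery.planarity G : ℝ) ∧
          NodeQuery.randGraphCost NodeQuery.planarity G ≤ Nat.card V)) ∧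
    (fun n : ℕ => (NodeQuery.minCost (NodeQuery.transitiveOfDegreeAtLeast.{u} 7)
      NodeQuery.planarity.{u} n : ℝ)) =Θ[atTop] (fun n : ℕ => (n : ℝ)) := by
  refine ⟨⟨1 / 24, by norm_num, fun V _ G hG _ => ?_⟩, ?_⟩
  · have h1 : (Nat.card V : ℝ) ≤ 8 * NodeQuery.graphCost NodeQuery.planarity G := by
      exact_mod_cast NodeQuery.card_le_eight_mul_graphCost hG
    have h2 : (Nat.card V : ℝ) ≤ 24 * NodeQuery.randGraphCost NodeQuery.planarity G := by
      exact_mod_cast NodeQuery.card_le_mul_randGraphCost hG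
    have h3 : (0 : ℝ) ≤ Nat.card V := Nat.cast_nonneg _
    exact ⟨⟨by linarith, NodeQuery.detComplexity_le_card _⟩,
      ⟨by linarith, NodeQuery.randComplexity_le_card _⟩⟩
  · refine ⟨IsBigO.of_bound 1 ?_, IsBigO.of_bound 8 ?_⟩ <;>
      filter_upwards [eventually_gt_atTop 7] with n hn
    · rw [Real.norm_natCast, Real.norm_natCast, one_mul]
      exact_mod_cast (NodeQuery.minCost_planarity_bounds hn).2
    · rw [Real.norm_natCast, Real.norm_natCast]
      exact_mod_cast (NodeQuery.minCost_planarity_bounds hn).1
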